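/- Let $\mathbb G$ be a Carnot group, that is, a connected simply connected Lie group whose Lie algebra of left-invariant vector fields decomposes as $\mathfrak g=\mathfrak g_1\oplus\dots\oplus\mathfrak g_m$ with $[\mathfrak g_1,\mathfrak g_i]=\mathfrak g_{i+1}$ for $1\le i<m$ and $[\mathfrak g_1,\mathfrak g_m]=0$. Fix an inner product on $\mathfrak g$ and an orthonormal basis $X_1,\dots,X_n$ of $\mathfrak g_1$, extend it to a basis of $\mathfrak g$ adapted to the decomposition, and use the exponential coordinates on $\mathbb G$ given by this basis, in which Lebesgue measure, multiplied by any positive constant, is a Haar measure $dx$. Let $\Omega\subset\mathbb G$ be a nonempty connected open set. For $1\le q<\infty$ the space $L^1_q(\Omega)$ consists of the functions $u\in L_{1,\mathrm{loc}}(\Omega)$ such that, for every $j=1,\dots,n$, the function $u$ can be redefined on a null set so that $t\mapsto u(\exp(tX_j)(x))$ is absolutely continuous on every segment $[a,b]\subset\{t:\exp(tX_j)(x)\in\Omega\}$ for almost every point $x$ of the hyperplane $\{x_j=0\}$ (with respect to the measure $\iota(X_j)\,dx$), and such that the resulting a.e. defined classical derivatives $X_ju$ belong to $L_q(\Omega)$.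 Write $\nabla_hu=(X_1u,\dots,X_nu)$ and let $|\nabla_hu|$ be its Euclidean norm. Let $(Y,d)$ be a metric space, $\varphi:\Omega\to Y$ any mapping, $V\subset Y$ an open set, $A\ge 0$ and $1\le q<\infty$. Put $\operatorname{spt}u=\overline{\{y\in Y: u(y)\ne0\}}$ and $\operatorname{dist}(E,F)=\inf\{d(x,y): x\in E,\ y\in F\}$, equal to $+\infty$ if $E$ or $F$ is empty. Suppose that every $1$-Lipschitz function $u:Y\to\mathbb R$ with $\operatorname{dist}(\operatorname{spt}u,\,Y\setminus V)>0$ satisfies $u\circ\varphi\in L^1_q(\Omega)$ and $$\int_{\varphi^{-1}(V)}|\nabla_h(u\circ\varphi)(x)|^q\,dx\le A .\tag{$*$}$$ Then $(*)$ holds for every $1$-Lipschitz function $u:Y\to\mathbb R$ with $u\circ\varphi\in L^1_q(\Omega)$. -/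

import Mathlib

open MeasureTheory
open scoped ENNReal

noncomputable section

/-- The span of the coordinate vectors of weight `i` in `ℝ^N`. -/
def weightLayer {N : ℕ} (weight : Fin N → ℕ) (i : ℕ) : Submodule ℝ (Fin N → ℝ) :=
  Submodule.span ℝ {v | ∃ k, weight k = i ∧ v = Pi.single k 1}

/-- For a product `mul` on `ℝ^N` with neutral element `0`: the left-invariant vector field whose
value at `0` is `X`. -/
def leftInvariantField {N : ℕ} (mul : (Fin N → ℝ) → (Fin N → ℝ) → (Fin N → ℝ))
    (X : Fin N → ℝ) (x : Fin N → ℝ) : Fin N → ℝ :=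
  fderiv ℝ (mul x) 0 X

/-- The Lie bracket on the tangent space at `0` (the Lie algebra of left-invariant fields): the
value at `0` of the commutator of the two left-invariant vector fields. -/
def lieAlgebraBracket {N : ℕ} (mul : (Fin N → ℝ) → (Fin N → ℝ) → (Fin N → ℝ))
    (X Y : Fin N → ℝ) : Fin N → ℝ :=
  VectorField.lieBracket ℝ (leftInvariantField mul X) (leftInvariantField mul Y) 0

/-- A Carnot group of topological dimension `N`, written in exponential coordinates of the first
kind with respect to a basis of its Lie algebra adapted to the stratification.

The underlying manifold is `ℝ^N`, so the group is connected and simply connected.  The group law is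
smooth and associative.  The lines `t ↦ t • x` are one-parameter subgroups, which says that the
exponential map is the identity; in particular `0` is the neutral element and `-x` is the inverse
of `x`.  The coordinate vectors of weight `i` form the chosen basis of the layer `𝔤_i`, `i ≥ 1`,
so that the Lie algebra is the direct sum of its layers, and `[𝔤_1, 𝔤_i] = 𝔤_{i+1}` for all
`i ≥ 1`.  Since only finitely many layers are nonzero, the latter includes `[𝔤_1, 𝔤_m] = 0` for
the last layer `𝔤_m`.

The basis of `𝔤_1` is the one that is orthonormal for the inner product that has been fixed. -/
structure CarnotGroup (N : ℕ) where
  /-- The group law. -/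
  mul : (Fin N → ℝ) → (Fin N → ℝ) → (Fin N → ℝ)
  contDiff_mul : ContDiff ℝ ((⊤ : ℕ∞) : WithTop ℕ∞)
    (fun p : (Fin N → ℝ) × (Fin N → ℝ) => mul p.1 p.2)
  mul_assoc : ∀ x y z, mul (mul x y) z = mul x (mul y z)
  mul_smul_smul : ∀ (x : Fin N → ℝ) (s t : ℝ), mul (s • x) (t • x) = (s + t) • x
  /-- The index of the layer to which each basis vector belongs. -/
  weight : Fin N → ℕ
  weight_pos : ∀ k, 1 ≤ weight k
  bracket_layer : ∀ i, 1 ≤ i →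
    Submodule.span ℝ {Z | ∃ X ∈ weightLayer weight 1, ∃ Y ∈ weightLayer weight i,
      Z = lieAlgebraBracket mul X Y} = weightLayer weight (i + 1)

namespace CarnotGroup

variable {N : ℕ} (G : CarnotGroup N)

/-- The indices `j` of the basis `X_j` of the horizontal space `𝔤_1`. -/
abbrev HorizontalIndex : Type := {k : Fin N // G.weight k = 1}

/-- The integral line `t ↦ exp (t X_j)(x) = x * exp (t X_j)` of the field `X_j` through `x`. -/
def line (j : G.HorizontalIndex) (x : Fin N → ℝ) (t : ℝ) : Fin N → ℝ :=
  G.mul x (t • Pi.single j.1 1)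

/-- The measure `μ_j = ι(X_j) dx` on the hyperplane `Π_j = {x | x_j = 0}`, regarded as a measure
on `ℝ^N` concentrated on `Π_j`.  On `Π_j` the contraction of `X_j` with the volume form is, up to
sign, the `j`-th coordinate of `X_j` times the Lebesgue volume form in the remaining coordinates.
(Only the null sets of this measure are used, so the normalization of `dx` plays no role.) -/
def hyperplaneMeasure (j : G.HorizontalIndex) : Measure (Fin N → ℝ) :=
  ((volume : Measure ({k : Fin N // k ≠ j.1} → ℝ)).map
    (fun y k => if h : k ≠ j.1 then y ⟨k, h⟩ else 0)).withDensity
    (fun x => ENNReal.ofReal |leftInvariantField G.mul (Pi.single j.1 1) x j.1|)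

/- Below, `μ` is the measure `dx`: a Haar measure, that is, Lebesgue measure up to a positive
factor.  Functions on `Ω` are functions on `ℝ^N` of which only the values on `Ω` matter. -/
variable (μ : Measure (Fin N → ℝ)) (Ω : Set (Fin N → ℝ))

/-- `v` arises from `u` by redefinition on a null subset of `Ω`, and `v` is absolutely continuous
on all segments in `Ω` of almost every integral line of `X_j`. -/
def IsACLRepresentative (j : G.HorizontalIndex) (u v : (Fin N → ℝ) → ℝ) : Prop :=
  v =ᵐ[μ.restrict Ω] u ∧
  ∀ᵐ x ∂(G.hyperplaneMeasure j), ∀ a b : ℝ, a ≤ b →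
    (∀ t ∈ Set.Icc a b, G.line j x t ∈ Ω) →
    AbsolutelyContinuousOnInterval (fun t => v (G.line j x t)) a b

/-- The class `ACL(Ω)` of (Lebesgue) measurable functions that are absolutely continuous on almost
all lines. -/
def MemACL (u : (Fin N → ℝ) → ℝ) : Prop :=
  AEMeasurable u (μ.restrict Ω) ∧ ∀ j, ∃ v, G.IsACLRepresentative μ Ω j u v

open Classical in
/-- The classical derivative `X_j u` of an `ACL` function `u`: the derivative along `X_j` of a
representative which is absolutely continuous on almost every integral line of `X_j`. It exists
and is independent of the representative almost everywhere in `Ω`. (It is set to `0` if there is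
no such representative.) -/
def horizontalDeriv (u : (Fin N → ℝ) → ℝ) (j : G.HorizontalIndex) (x : Fin N → ℝ) : ℝ :=
  if h : ∃ v, G.IsACLRepresentative μ Ω j u v then
    deriv (fun t => h.choose (G.line j x t)) 0
  else 0

/-- The horizontal gradient `∇_h u = (X_1 u, …, X_n u)`, with the Euclidean norm. -/
def horizontalGradient (u : (Fin N → ℝ) → ℝ) (x : Fin N → ℝ) :
    EuclideanSpace ℝ G.HorizontalIndex :=
  WithLp.toLp 2 (fun j => G.horizontalDeriv μ Ω u j x)

/-- The homogeneous Sobolev space `L^1_q(Ω)`, `1 ≤ q < ∞`: the functions in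
`L_{1,loc}(Ω) ∩ ACL(Ω)` whose derivatives `X_j u` belong to `L_q(Ω)`. -/
def MemSobolev (q : ℝ) (u : (Fin N → ℝ) → ℝ) : Prop :=
  (∀ K ⊆ Ω, IsCompact K → IntegrableOn u K μ) ∧
  G.MemACL μ Ω u ∧
  ∀ j, MemLp (G.horizontalDeriv μ Ω u j) (ENNReal.ofReal q) (μ.restrict Ω)

end CarnotGroup

/-- The distance between two subsets of a metric space, equal to `∞` if one of them is empty. -/
def setDist {Y : Type*} [MetricSpace Y] (E F : Set Y) : ℝ≥0∞ :=
  ⨅ x ∈ E, ⨅ y ∈ F, edist x y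

end

/-! Instead of being multiplied by a cutoff, which would spoil the Lipschitz constant, `u` is
folded. Let s be the sawtooth of slopes ±1 and range [0, ε]. Then w = min(s ∘ u, (dist(·, Vᶜ) - ε)⁺)
is 1-Lipschitz, its support has distance at least ε from Vᶜ, and w = s ∘ u where dist(·, Vᶜ) > 2ε.
Folding does not shrink derivatives, so on the preimage E of that region |∇_h(u ∘ φ)| ≤ |∇_h(w ∘ φ)|
a.e., and the energy of u ∘ φ over E is at most A. Monotone convergence as ε → 0 concludes.

As φ is arbitrary, E is only measurable, and the comparison of gradients must be local in a
measure-theoretic sense (`ae_abs_horizontalDeriv_le`). On almost every integral line of X_j, almost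
every time spent in E is an accumulation point of such times at which the ACL representatives also
agree with the functions. Along these times the difference quotients of the two functions have equal
absolute values.

To pass between lines and dx one uses that right translations preserve null sets, and that X_j has
j-th coordinate 1, so that ι(X_j)dx is Lebesgue measure on {x_j = 0}. The latter comes from the
stratification: brackets have no component in 𝔤_1, so the horizontal components of the Maurer–Cartan
form are closed, and in exponential coordinates this forces them to be dx_j. -/

namespace CarnotGroup

variable {N : ℕ} (G : CarnotGroup N)

/-! ### Left-invariant fields and the Lie bracket -/

theorem zero_mul (x : Fin N → ℝ) : G.mul 0 x = x := by
  simpa using G.mul_smul_smul x 0 1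

theorem mul_zero (x : Fin N → ℝ) : G.mul x 0 = x := by
  simpa using G.mul_smul_smul x 1 0

theorem mul_neg (x : Fin N → ℝ) : G.mul x (-x) = 0 := by
  simpa using G.mul_smul_smul x 1 (-1)

theorem neg_mul (x : Fin N → ℝ) : G.mul (-x) x = 0 := by
  simpa using G.mul_smul_smul x (-1) 1

theorem mul_neg_mul (x y : Fin N → ℝ) : G.mul x (G.mul (-x) y) = y := by
  rw [← G.mul_assoc, G.mul_neg, G.zero_mul]

theorem neg_mul_mul (x y : Fin N → ℝ) : G.mul (-x) (G.mul x y) = y := by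
  rw [← G.mul_assoc, G.neg_mul, G.zero_mul]

theorem contDiff_mul_left (x : Fin N → ℝ) : ContDiff ℝ ((⊤ : ℕ∞) : WithTop ℕ∞) (G.mul x) :=
  G.contDiff_mul.comp (contDiff_const.prodMk contDiff_id)

theorem differentiable_mul_left (x : Fin N → ℝ) : Differentiable ℝ (G.mul x) :=
  (G.contDiff_mul_left x).differentiable (by simp)

/-- Left translations preserve left-invariant fields. -/
theorem fderiv_mul_leftInvariantField (x y Y : Fin N → ℝ) :
    fderiv ℝ (G.mul x) y (leftInvariantField G.mul Y y) =
      leftInvariantField G.mul Y (G.mul x y) := by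
  have hcomp : G.mul (G.mul x y) = G.mul x ∘ G.mul y := by
    ext1 z; simp [G.mul_assoc]
  unfold leftInvariantField
  rw [hcomp, fderiv_comp _ (G.differentiable_mul_left x _) (G.differentiable_mul_left y _),
    G.mul_zero]
  rfl

theorem leftInvariantField_zero (Y : Fin N → ℝ) : leftInvariantField G.mul Y 0 = Y := by
  have : G.mul 0 = id := by ext1 z; simp [G.zero_mul]
  simp [leftInvariantField, this]

theorem hasDerivAt_mul_smul (x Y : Fin N → ℝ) (t : ℝ) :
    HasDerivAt (fun s : ℝ => G.mul x (s • Y)) (leftInvariantField G.mul Y (G.mul x (t • Y))) t := by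
  have h0 : HasDerivAt (fun s : ℝ => (s - t) • Y) Y t := by
    simpa using ((hasDerivAt_id t).sub_const t).smul_const Y
  have h1 : HasFDerivAt (G.mul (G.mul x (t • Y))) (fderiv ℝ (G.mul (G.mul x (t • Y))) 0)
      ((t - t) • Y) := by
    simpa using (G.differentiable_mul_left (G.mul x (t • Y)) 0).hasFDerivAt
  have h2 := h1.comp_hasDerivAt t h0
  refine h2.congr_of_eventuallyEq (Filter.Eventually.of_forall fun s => ?_)
  simp only [Function.comp]
  rw [G.mul_assoc, G.mul_smul_smul]
  simp

theorem leftInvariantField_smul_self (t : ℝ) (x : Fin N → ℝ) :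
    leftInvariantField G.mul x (t • x) = x := by
  have h := G.hasDerivAt_mul_smul 0 x t
  simp only [G.zero_mul] at h
  refine h.unique ?_
  simpa using (hasDerivAt_id t).smul_const x

theorem contDiff_fderiv_mul :
    ContDiff ℝ ((⊤ : ℕ∞) : WithTop ℕ∞) (fun x => fderiv ℝ (G.mul x) 0) :=
  ContDiff.fderiv (f := G.mul) (m := ((⊤ : ℕ∞) : WithTop ℕ∞)) G.contDiff_mul contDiff_const
    (by simp)

theorem contDiff_leftInvariantField (Y : Fin N → ℝ) :
    ContDiff ℝ ((⊤ : ℕ∞) : WithTop ℕ∞) (leftInvariantField G.mul Y) :=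
  G.contDiff_fderiv_mul.clm_apply contDiff_const

theorem fderiv_mul_neg_mul (x y w : Fin N → ℝ) :
    fderiv ℝ (G.mul x) (G.mul (-x) y) (fderiv ℝ (G.mul (-x)) y w) = w := by
  have hcomp : G.mul x ∘ G.mul (-x) = id := by ext1 z; simp [G.mul_neg_mul]
  have := fderiv_comp y (G.differentiable_mul_left x _) (G.differentiable_mul_left (-x) y)
  rw [hcomp, fderiv_id] at this
  exact (DFunLike.congr_fun this w).symm

theorem isInvertible_fderiv_mul (x y : Fin N → ℝ) : (fderiv ℝ (G.mul x) y).IsInvertible := by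
  have h1 : ∀ w, fderiv ℝ (G.mul x) y (fderiv ℝ (G.mul (-x)) (G.mul x y) w) = w := fun w => by
    have := G.fderiv_mul_neg_mul x (G.mul x y) w
    rwa [G.neg_mul_mul] at this
  have h2 : ∀ w, fderiv ℝ (G.mul (-x)) (G.mul x y) (fderiv ℝ (G.mul x) y w) = w := fun w => by
    have := G.fderiv_mul_neg_mul (-x) y w
    rwa [neg_neg] at this
  exact ⟨ContinuousLinearEquiv.equivOfInverse _ _ h2 h1, rfl⟩

theorem pullback_leftInvariantField (x Y : Fin N → ℝ) :
    VectorField.pullback ℝ (G.mul x) (leftInvariantField G.mul Y) = leftInvariantField G.mul Y := by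
  ext1 y
  rw [VectorField.pullback, ← G.fderiv_mul_leftInvariantField]
  obtain ⟨e, he⟩ := G.isInvertible_fderiv_mul x y
  rw [← he]
  simp

/-- The bracket of left-invariant fields is left-invariant. -/
theorem lieBracket_leftInvariantField (Y Z : Fin N → ℝ) :
    VectorField.lieBracket ℝ (leftInvariantField G.mul Y) (leftInvariantField G.mul Z) =
      leftInvariantField G.mul (lieAlgebraBracket G.mul Y Z) := by
  ext1 x
  have h := VectorField.pullback_lieBracket (𝕜 := ℝ) (n := ((⊤ : ℕ∞) : WithTop ℕ∞)) (x := 0)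
    (by simpa using WithTop.coe_le_coe.2 (le_top : (2 : ℕ∞) ≤ ⊤)) (G.contDiff_mul_left x).contDiffAt
    ((G.contDiff_leftInvariantField Y).differentiable (by simp) (G.mul x 0))
    ((G.contDiff_leftInvariantField Z).differentiable (by simp) (G.mul x 0))
  rw [G.pullback_leftInvariantField, G.pullback_leftInvariantField] at h
  obtain ⟨e, he⟩ := G.isInvertible_fderiv_mul x 0
  rw [VectorField.pullback, ← he, G.mul_zero] at h
  rw [leftInvariantField, lieAlgebraBracket, ← h, ← he]
  simp

/-- This form makes the bilinearity of the bracket evident. -/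
theorem lieAlgebraBracket_eq (Y Z : Fin N → ℝ) :
    lieAlgebraBracket G.mul Y Z =
      fderiv ℝ (fun x => fderiv ℝ (G.mul x) 0) 0 Y Z -
      fderiv ℝ (fun x => fderiv ℝ (G.mul x) 0) 0 Z Y := by
  have key : ∀ Z w : Fin N → ℝ, fderiv ℝ (leftInvariantField G.mul Z) 0 w =
      fderiv ℝ (fun x => fderiv ℝ (G.mul x) 0) 0 w Z := fun Z w => by
    have hd := G.contDiff_fderiv_mul.differentiable (by simp) 0
    have := fderiv_clm_apply hd (differentiableAt_const (c := Z))
    unfold leftInvariantField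
    rw [this]
    simp
  rw [lieAlgebraBracket, VectorField.lieBracket, key, key, G.leftInvariantField_zero,
    G.leftInvariantField_zero]

theorem jacobi (X Y Z : Fin N → ℝ) :
    lieAlgebraBracket G.mul (lieAlgebraBracket G.mul X Y) Z =
      lieAlgebraBracket G.mul X (lieAlgebraBracket G.mul Y Z) -
      lieAlgebraBracket G.mul Y (lieAlgebraBracket G.mul X Z) := by
  have h := VectorField.leibniz_identity_lieBracket (𝕜 := ℝ) (n := ((⊤ : ℕ∞) : WithTop ℕ∞)) (x := 0)
    (by simpa using WithTop.coe_le_coe.2 (le_top : (2 : ℕ∞) ≤ ⊤)) (G.contDiff_leftInvariantField X).contDiffAt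
    (G.contDiff_leftInvariantField Y).contDiffAt (G.contDiff_leftInvariantField Z).contDiffAt
  simp only [G.lieBracket_leftInvariantField, G.leftInvariantField_zero] at h
  rw [h, add_sub_cancel_right]

theorem weightLayer_apply_eq_zero {weight : Fin N → ℕ} {i : ℕ} {j : Fin N} (hj : weight j ≠ i)
    {v : Fin N → ℝ} (hv : v ∈ weightLayer weight i) : v j = 0 := by
  induction hv using Submodule.span_induction with
  | mem v hv =>
    obtain ⟨k, rfl, rfl⟩ := hv
    exact Pi.single_eq_of_ne (fun h => hj (congrArg weight h)) _
  | zero => rfl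
  | add v w _ _ h1 h2 => simp [h1, h2]
  | smul c v _ h => simp [h]

theorem induction_weightLayer (v : Fin N → ℝ) (p : (Fin N → ℝ) → Prop)
    (hp : ∀ i, 1 ≤ i → ∀ v ∈ weightLayer G.weight i, p v) (h0 : p 0)
    (hadd : ∀ v w, p v → p w → p (v + w)) : p v := by
  have hv : v = ∑ k, Pi.single k (v k) := by simp [Finset.univ_sum_single]
  rw [hv]
  refine Finset.sum_induction _ p (fun v w => hadd v w) h0 fun k _ => ?_
  refine hp _ (G.weight_pos k) _ ?_
  have : (Pi.single k (v k) : Fin N → ℝ) = v k • Pi.single k 1 := by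
    rw [← Pi.single_smul]; simp
  rw [this]
  exact Submodule.smul_mem _ _ (Submodule.subset_span ⟨k, rfl, rfl⟩)

/-- Brackets have no component in the first layer. -/
theorem lieAlgebraBracket_apply_horizontal (j : G.HorizontalIndex) (Y Z : Fin N → ℝ) :
    lieAlgebraBracket G.mul Y Z j.1 = 0 := by
  have hadd : ∀ Y Z W, lieAlgebraBracket G.mul (Y + Z) W j.1 =
      lieAlgebraBracket G.mul Y W j.1 + lieAlgebraBracket G.mul Z W j.1 := fun Y Z W => by
    simp only [G.lieAlgebraBracket_eq, map_add, add_apply, Pi.sub_apply,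
      Pi.add_apply]
    ring
  have hadd' : ∀ Y Z W, lieAlgebraBracket G.mul W (Y + Z) j.1 =
      lieAlgebraBracket G.mul W Y j.1 + lieAlgebraBracket G.mul W Z j.1 := fun Y Z W => by
    simp only [G.lieAlgebraBracket_eq, map_add, add_apply, Pi.sub_apply,
      Pi.add_apply]
    ring
  have hsmul : ∀ (c : ℝ) Y W, lieAlgebraBracket G.mul (c • Y) W j.1 =
      c * lieAlgebraBracket G.mul Y W j.1 := fun c Y W => by
    simp only [G.lieAlgebraBracket_eq, map_smul, smul_apply, Pi.sub_apply,
      Pi.smul_apply, smul_eq_mul]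
    ring
  have hzero : ∀ W, lieAlgebraBracket G.mul 0 W j.1 = 0 := fun W => by
    simp [G.lieAlgebraBracket_eq]
  have hzero' : ∀ W, lieAlgebraBracket G.mul W 0 j.1 = 0 := fun W => by
    simp [G.lieAlgebraBracket_eq]
  have first : ∀ X ∈ weightLayer G.weight 1, ∀ W, lieAlgebraBracket G.mul X W j.1 = 0 := by
    intro X hX W
    refine G.induction_weightLayer W (fun W => lieAlgebraBracket G.mul X W j.1 = 0)
      (fun i hi W hW => ?_) (hzero' X) fun V W hV hW => by rw [hadd', hV, hW, add_zero]
    refine weightLayer_apply_eq_zero (weight := G.weight) (i := i + 1) (by rw [j.2]; omega) ?_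
    rw [← G.bracket_layer i hi]
    exact Submodule.subset_span ⟨X, hX, W, hW, rfl⟩
  -- The layer hypothesis only concerns brackets with 𝔤_1. As 𝔤_{i+1} is spanned by [X, Y] with X ∈
  -- 𝔤_1 and Y ∈ 𝔤_i, the Jacobi identity gives the other layers by induction.
  have all : ∀ i, 1 ≤ i → ∀ X ∈ weightLayer G.weight i, ∀ W,
      lieAlgebraBracket G.mul X W j.1 = 0 := by
    intro i hi
    induction i, hi using Nat.le_induction with
    | base => exact first
    | succ i hi ih =>
      intro V hV W
      rw [← G.bracket_layer i hi] at hV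
      induction hV using Submodule.span_induction with
      | mem V hV =>
        obtain ⟨X, hX, Y, hY, rfl⟩ := hV
        rw [G.jacobi, Pi.sub_apply, first X hX, ih Y hY, sub_zero]
      | zero => exact hzero W
      | add V V' _ _ h1 h2 => rw [hadd, h1, h2, add_zero]
      | smul c V _ h => rw [hsmul, h, MulZeroClass.mul_zero]
  exact G.induction_weightLayer Y (fun Y => lieAlgebraBracket G.mul Y Z j.1 = 0)
    (fun i hi Y hY => all i hi Y hY Z) (hzero Z) fun V W hV hW => by rw [hadd, hV, hW, add_zero]

/-! ### The Maurer–Cartan form in exponential coordinates -/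

/-- The left Maurer–Cartan form. -/
noncomputable def maurerCartan (x : Fin N → ℝ) : (Fin N → ℝ) →L[ℝ] (Fin N → ℝ) := fderiv ℝ (G.mul (-x)) x

theorem contDiff_maurerCartan : ContDiff ℝ ((⊤ : ℕ∞) : WithTop ℕ∞) G.maurerCartan :=
  ContDiff.fderiv (f := fun x => G.mul (-x)) (m := ((⊤ : ℕ∞) : WithTop ℕ∞))
    (G.contDiff_mul.comp (contDiff_fst.neg.prodMk contDiff_snd)) contDiff_id (by simp)

theorem maurerCartan_leftInvariantField (x Y : Fin N → ℝ) :
    G.maurerCartan x (leftInvariantField G.mul Y x) = Y := by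
  rw [maurerCartan, G.fderiv_mul_leftInvariantField, G.neg_mul, G.leftInvariantField_zero]

theorem leftInvariantField_maurerCartan (x w : Fin N → ℝ) :
    leftInvariantField G.mul (G.maurerCartan x w) x = w := by
  have := G.fderiv_mul_neg_mul x x w
  rwa [G.neg_mul] at this

/-- Differentiate the constant function obtained by evaluating the form on a left-invariant field.
-/
theorem fderiv_maurerCartan_leftInvariantField (x v Z : Fin N → ℝ) :
    fderiv ℝ G.maurerCartan x v (leftInvariantField G.mul Z x) =
      - G.maurerCartan x (fderiv ℝ (leftInvariantField G.mul Z) x v) := by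
  have h := fderiv_clm_apply (G.contDiff_maurerCartan.differentiable (by simp) x)
    ((G.contDiff_leftInvariantField Z).differentiable (by simp) x)
  simp only [G.maurerCartan_leftInvariantField] at h
  have h' := DFunLike.congr_fun h v
  simp only [fderiv_fun_const, Pi.zero_apply, zero_apply,
    add_apply, ContinuousLinearMap.comp_apply,
    ContinuousLinearMap.flip_apply] at h'
  rw [eq_neg_iff_add_eq_zero, add_comm]
  exact h'.symm

/-- The horizontal components of the Maurer–Cartan form are closed. -/
theorem fderiv_maurerCartan_symm (j : G.HorizontalIndex) (x v w : Fin N → ℝ) :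
    fderiv ℝ G.maurerCartan x v w j.1 = fderiv ℝ G.maurerCartan x w v j.1 := by
  obtain ⟨Y, rfl⟩ : ∃ Y, leftInvariantField G.mul Y x = v := ⟨_, G.leftInvariantField_maurerCartan x v⟩
  obtain ⟨Z, rfl⟩ : ∃ Z, leftInvariantField G.mul Z x = w := ⟨_, G.leftInvariantField_maurerCartan x w⟩
  rw [fderiv_maurerCartan_leftInvariantField, fderiv_maurerCartan_leftInvariantField]
  have h := congrFun (G.lieBracket_leftInvariantField Y Z) x
  rw [VectorField.lieBracket] at h
  have h2 := congrArg (fun v => G.maurerCartan x v j.1) h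
  simp only [map_sub, G.maurerCartan_leftInvariantField, Pi.sub_apply,
    G.lieAlgebraBracket_apply_horizontal] at h2
  simp only [Pi.neg_apply]
  linarith

theorem maurerCartan_apply_horizontal (j : G.HorizontalIndex) (x h : Fin N → ℝ) :
    G.maurerCartan x h j.1 = h j.1 := by
  have hdiff : Differentiable ℝ G.maurerCartan := G.contDiff_maurerCartan.differentiable (by simp)
  -- With ω the Maurer–Cartan form, ω_{tz}(z) = z because t ↦ tz is a one-parameter subgroup.
  -- Differentiate this in z, at x in the direction h.
  have radial : ∀ t : ℝ, t * fderiv ℝ G.maurerCartan (t • x) h x j.1 +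
      G.maurerCartan (t • x) h j.1 = h j.1 := fun t => by
    have h1 : (fun z => G.maurerCartan (t • z) z) = id := by
      ext1 z
      have := G.maurerCartan_leftInvariantField (t • z) z
      rwa [G.leftInvariantField_smul_self] at this
    have h2 : HasFDerivAt (fun z : Fin N → ℝ => G.maurerCartan (t • z))
        ((fderiv ℝ G.maurerCartan (t • x)).comp (t • ContinuousLinearMap.id ℝ _)) x :=
      (hdiff (t • x)).hasFDerivAt.comp x ((hasFDerivAt_id x).const_smul t)
    have h3 := h2.clm_apply (hasFDerivAt_id x)
    have h4 : HasFDerivAt (fun z => G.maurerCartan (t • z) z) (ContinuousLinearMap.id ℝ _) x := by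
      rw [h1]; exact hasFDerivAt_id x
    have h5 := congrFun (DFunLike.congr_fun (h3.unique h4) h) j.1
    simp at h5
    linarith
  -- Closedness swaps the two arguments in `radial`, whose left side becomes the derivative of t
  -- ω_{tx}(h)_j. Comparing t = 0 with t = 1 then gives the claim.
  have hβ : ∀ t : ℝ, HasDerivAt (fun t : ℝ => t * G.maurerCartan (t • x) h j.1) (h j.1) t := by
    intro t
    have h1 : HasDerivAt (fun t : ℝ => G.maurerCartan (t • x))
        (fderiv ℝ G.maurerCartan (t • x) x) t := by
      have := (hdiff (t • x)).hasFDerivAt.comp_hasDerivAt t ((hasDerivAt_id t).smul_const x)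
      simp only [one_smul, id] at this
      exact this
    have h2 := (hasDerivAt_pi.1 (h1.clm_apply (hasDerivAt_const t h))) j.1
    have h3 := (hasDerivAt_id t).mul h2
    have := radial t
    rw [fderiv_maurerCartan_symm] at this
    rw [ContinuousLinearMap.map_zero, add_zero, one_mul, id, add_comm, this] at h3
    exact h3
  have hconst := is_const_of_deriv_eq_zero
    (f := fun t : ℝ => t * G.maurerCartan (t • x) h j.1 - t * h j.1)
    (fun t => ((hβ t).sub ((hasDerivAt_id t).mul_const _)).differentiableAt)
    (fun t => by
      have := ((hβ t).sub ((hasDerivAt_id t).mul_const (h j.1))).deriv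
      rw [one_mul, sub_self] at this
      exact this) 1 0
  simp at hconst
  linarith

theorem leftInvariantField_apply_horizontal (j : G.HorizontalIndex) (x Y : Fin N → ℝ) :
    leftInvariantField G.mul Y x j.1 = Y j.1 := by
  rw [← G.maurerCartan_apply_horizontal j x (leftInvariantField G.mul Y x),
    G.maurerCartan_leftInvariantField]

theorem hasDerivAt_line (j : G.HorizontalIndex) (x : Fin N → ℝ) (t : ℝ) :
    HasDerivAt (G.line j x) (leftInvariantField G.mul (Pi.single j.1 1) (G.line j x t)) t :=
  G.hasDerivAt_mul_smul x (Pi.single j.1 1) t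

/-- Unit speed in the j-th coordinate: each integral line crosses {x_j = 0} exactly once, at time
-x_j when started at x. -/
theorem line_apply_horizontal (j : G.HorizontalIndex) (x : Fin N → ℝ) (t : ℝ) :
    G.line j x t j.1 = x j.1 + t := by
  have hd : ∀ t, HasDerivAt (fun t => G.line j x t j.1 - t) 0 t := fun t => by
    have := (hasDerivAt_pi.1 (G.hasDerivAt_line j x t) j.1).sub (hasDerivAt_id t)
    rw [G.leftInvariantField_apply_horizontal, Pi.single_eq_same, sub_self] at this
    exact this
  have := is_const_of_deriv_eq_zero (fun t => (hd t).differentiableAt) (fun t => (hd t).deriv) t 0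
  simp only [line, zero_smul, G.mul_zero] at this ⊢
  linarith

theorem line_line (j : G.HorizontalIndex) (x : Fin N → ℝ) (s t : ℝ) :
    G.line j (G.line j x s) t = G.line j x (s + t) := by
  rw [line, line, G.mul_assoc, G.mul_smul_smul, line]

theorem line_zero (j : G.HorizontalIndex) (x : Fin N → ℝ) : G.line j x 0 = x := by
  simp [line, G.mul_zero]

theorem contDiff_line (j : G.HorizontalIndex) :
    ContDiff ℝ ((⊤ : ℕ∞) : WithTop ℕ∞) (fun p : (Fin N → ℝ) × ℝ => G.line j p.1 p.2) :=
  G.contDiff_mul.comp (contDiff_fst.prodMk (contDiff_snd.smul contDiff_const))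

end CarnotGroup

/-! ### Null sets and integral lines -/

namespace CarnotGroup

variable {N : ℕ} (G : CarnotGroup N)

theorem measurable_line (j : G.HorizontalIndex) :
    Measurable (fun p : (Fin N → ℝ) × ℝ => G.line j p.1 p.2) :=
  (G.contDiff_line j).continuous.measurable

theorem differentiable_line_left (j : G.HorizontalIndex) (t : ℝ) :
    Differentiable ℝ (fun x => G.line j x t) :=
  ((G.contDiff_line j).differentiable (by simp)).comp
    (differentiable_id.prodMk (differentiable_const t))

theorem continuous_line (j : G.HorizontalIndex) (x : Fin N → ℝ) : Continuous (G.line j x) :=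
  (G.contDiff_line j).continuous.comp (continuous_const.prodMk continuous_id)

/-- The flow at time t is inverted by the flow at time -t, so the preimage of a null set is a
differentiable image of it. -/
theorem quasiMeasurePreserving_line (μ : Measure (Fin N → ℝ)) [μ.IsAddHaarMeasure]
    (j : G.HorizontalIndex) (t : ℝ) : Measure.QuasiMeasurePreserving (fun x => G.line j x t) μ μ := by
  refine ⟨(G.differentiable_line_left j t).continuous.measurable,
    Measure.AbsolutelyContinuous.mk fun s hs h0 => ?_⟩
  rw [Measure.map_apply (G.differentiable_line_left j t).continuous.measurable hs]
  refine measure_mono_null (fun x hx => ?_)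
    (addHaar_image_eq_zero_of_differentiableOn_of_addHaar_eq_zero μ
      (G.differentiable_line_left j (-t)).differentiableOn h0)
  exact ⟨G.line j x t, hx, by simp [G.line_line, G.line_zero]⟩

theorem ae_ae_line (μ : Measure (Fin N → ℝ)) [μ.IsAddHaarMeasure] (j : G.HorizontalIndex)
    {T : (Fin N → ℝ) → Prop} (hT : ∀ᵐ x ∂μ, T x) :
    ∀ᵐ x ∂μ, ∀ᵐ t : ℝ, T (G.line j x t) := by
  have hq : Measure.QuasiMeasurePreserving (fun p : (Fin N → ℝ) × ℝ => G.line j p.1 p.2)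
      (μ.prod volume) μ :=
    QuasiMeasurePreserving.prod_of_left (G.measurable_line j)
      (Filter.Eventually.of_forall fun t => G.quasiMeasurePreserving_line μ j t)
  exact Measure.ae_ae_of_ae_prod (hq.ae hT)

/-- After exchanging quantifiers by Fubini, a single good t suffices: flow back by -t. -/
theorem ae_of_ae_ae_line (μ : Measure (Fin N → ℝ)) [μ.IsAddHaarMeasure] (j : G.HorizontalIndex)
    {D : Set (Fin N → ℝ)} (hD : NullMeasurableSet D μ)
    (h : ∀ᵐ x ∂μ, ∀ᵐ t : ℝ, G.line j x t ∉ D) : μ D = 0 := by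
  obtain ⟨D', hsub, hmeas, hae⟩ := hD.exists_measurable_subset_ae_eq
  rw [← measure_congr hae]
  have h' : ∀ᵐ x ∂μ, ∀ᵐ t : ℝ, G.line j x t ∉ D' := by
    filter_upwards [h] with x hx
    filter_upwards [hx] with t ht using fun hm => ht (hsub hm)
  rw [Measure.ae_ae_comm (p := fun x t => G.line j x t ∉ D')
    ((G.measurable_line j) hmeas.compl)] at h'
  obtain ⟨t, ht⟩ := h'.exists
  have := (G.quasiMeasurePreserving_line μ j (-t)).ae ht
  simp only [G.line_line, neg_add_cancel, G.line_zero] at this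
  exact measure_eq_zero_iff_ae_notMem.2 this

theorem hyperplaneMeasure_eq (j : G.HorizontalIndex) :
    G.hyperplaneMeasure j = (volume : Measure ({k : Fin N // k ≠ j.1} → ℝ)).map
      (fun y k => if h : k ≠ j.1 then y ⟨k, h⟩ else 0) := by
  unfold hyperplaneMeasure
  simp only [G.leftInvariantField_apply_horizontal, Pi.single_eq_same, abs_one, ENNReal.ofReal_one]
  exact withDensity_one

/-- Almost every point lies on an integral line through a generic point of the hyperplane. -/
theorem ae_of_ae_hyperplaneMeasure (μ : Measure (Fin N → ℝ)) [μ.IsAddHaarMeasure]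
    (j : G.HorizontalIndex) {P : (Fin N → ℝ) → Prop} (h : ∀ᵐ x ∂G.hyperplaneMeasure j, P x) :
    ∀ᵐ x ∂μ, P (G.line j x (-x j.1)) := by
  set ι : ({k : Fin N // k ≠ j.1} → ℝ) → (Fin N → ℝ) :=
    fun y k => if h : k ≠ j.1 then y ⟨k, h⟩ else 0 with hι
  have hιm : Measurable ι := by
    refine measurable_pi_lambda _ fun k => ?_
    by_cases hk : k ≠ j.1
    · simp only [hι, hk, dif_pos, ne_eq, not_false_eq_true]; exact measurable_pi_apply _
    · simp only [hι, hk, dif_neg, not_false_eq_true]; exact measurable_const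
  rw [hyperplaneMeasure_eq] at h
  have hP : ∀ᵐ y, P (ι y) := ae_of_ae_map hιm.aemeasurable h
  have hr : Measure.QuasiMeasurePreserving
      (fun (z : Fin N → ℝ) (k : {k : Fin N // k ≠ j.1}) => z k.1) volume volume :=
    Measure.quasiMeasurePreserving_fst.comp
      (volume_preserving_piEquivPiSubtypeProd (fun _ : Fin N => ℝ)
        (fun k => k ≠ j.1)).quasiMeasurePreserving
  have hz : ∀ᵐ z ∂μ, P (ι fun k => z k.1) := by
    rw [Measure.isAddLeftInvariant_eq_smul μ volume]
    exact Measure.ae_smul_measure (hr.ae hP) _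
  have hιz : ∀ z : Fin N → ℝ, ι (fun k => z k.1) = z - z j.1 • Pi.single j.1 1 := fun z => by
    ext k
    by_cases hk : k = j.1
    · subst hk; simp [hι]
    · simp [hι, hk]
  -- This map straightens the integral lines. Being differentiable, it sends the null set of z with
  -- bad projection to a null set, which contains every bad x.
  have hdiff : Differentiable ℝ
      (fun z : Fin N → ℝ => G.line j (z - z j.1 • Pi.single j.1 1) (z j.1)) := by
    refine ((G.contDiff_line j).differentiable (by simp)).comp
      (Differentiable.prodMk ?_ ?_) <;> fun_prop
  refine measure_mono_null (fun x hx => ?_)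
    (addHaar_image_eq_zero_of_differentiableOn_of_addHaar_eq_zero μ hdiff.differentiableOn hz)
  set y := G.line j x (-x j.1) with hy
  have hyj : y j.1 = 0 := by rw [hy, G.line_apply_horizontal]; ring
  refine ⟨y + x j.1 • Pi.single j.1 1, ?_, ?_⟩
  · simp only [Set.mem_compl_iff, Set.mem_ofPred_eq, hιz] at hx ⊢
    simpa [hyj] using hx
  · have : G.line j y (x j.1) = x := by simp [hy, G.line_line, G.line_zero]
    simpa [hyj] using this

end CarnotGroup

/-! ### Derivatives along subsets of the real line -/

open Filter Topology in
-- The isolated points of E form a set that is locally a single point, hence null; E need not be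
-- measurable.
theorem ae_mem_imp_neBot_nhdsWithin_diff_singleton (E : Set ℝ) :
    ∀ᵐ t : ℝ, t ∈ E → (𝓝[E \ {t}] t).NeBot := by
  rw [ae_iff]
  refine measure_null_of_locally_null _ fun t ht => ?_
  simp only [Classical.not_imp, not_neBot, Set.mem_ofPred_eq] at ht
  obtain ⟨htE, hbot⟩ := ht
  rw [← empty_mem_iff_bot, mem_nhdsWithin_iff_exists_mem_nhds_inter] at hbot
  obtain ⟨W, hW, hWE⟩ := hbot
  refine ⟨_, inter_mem_nhdsWithin _ hW, measure_mono_null (t := {t}) ?_ (by simp)⟩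
  rintro s ⟨hs, hsW⟩
  simp only [Classical.not_imp, Set.mem_ofPred_eq] at hs
  by_contra hst
  exact hWE ⟨hsW, hs.1, hst⟩

open Filter Topology in
theorem ae_differentiableAt_of_absolutelyContinuousOnInterval {g : ℝ → ℝ} {U : Set ℝ}
    (hU : IsOpen U)
    (hg : ∀ a b : ℝ, a ≤ b → (∀ t ∈ Set.Icc a b, t ∈ U) → AbsolutelyContinuousOnInterval g a b) :
    ∀ᵐ t : ℝ, t ∈ U → DifferentiableAt ℝ g t := by
  rw [ae_iff]
  refine measure_null_of_locally_null _ fun t ht => ?_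
  simp only [Classical.not_imp, Set.mem_ofPred_eq] at ht
  obtain ⟨ε, hε, hsub⟩ := Metric.nhds_basis_closedBall.mem_iff.1 (hU.mem_nhds ht.1)
  rw [Real.closedBall_eq_Icc] at hsub
  have h := (hg (t - ε) (t + ε) (by linarith) hsub).ae_differentiableAt
  rw [ae_iff] at h
  refine ⟨_, inter_mem_nhdsWithin _ (Icc_mem_nhds (a := t - ε) (b := t + ε) (by linarith)
    (by linarith)), measure_mono_null ?_ h⟩
  rintro s ⟨hs, hsI⟩
  simp only [Classical.not_imp, Set.mem_ofPred_eq] at hs ⊢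
  rw [Set.uIcc_of_le (by linarith)]
  exact ⟨hsI, hs.2⟩

open Filter Topology in
theorem abs_deriv_le_of_eventually_abs_sub_eq {f g w : ℝ → ℝ} {E : Set ℝ} {t : ℝ}
    (hf : ∀ s₀, ∀ᶠ s in 𝓝 s₀, |f s - f s₀| = |s - s₀|) (hE : ∀ s ∈ E, w s = f (g s))
    (ht : t ∈ E) (hne : (𝓝[E \ {t}] t).NeBot) (hw : DifferentiableAt ℝ w t) :
    |deriv g t| ≤ |deriv w t| := by
  by_cases hg : DifferentiableAt ℝ g t
  · have hle : 𝓝[E \ {t}] t ≤ 𝓝[≠] t := nhdsWithin_mono _ fun s hs => hs.2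
    have h1 := ((hasDerivAt_iff_tendsto_slope.1 hg.hasDerivAt).mono_left hle).abs
    have h2 := ((hasDerivAt_iff_tendsto_slope.1 hw.hasDerivAt).mono_left hle).abs
    refine (tendsto_nhds_unique h1 (h2.congr' ?_)).le
    have h3 : ∀ᶠ s in 𝓝[E \ {t}] t, |f (g s) - f (g t)| = |g s - g t| :=
      (hg.continuousAt.tendsto.eventually (hf (g t))).filter_mono nhdsWithin_le_nhds
    filter_upwards [h3, self_mem_nhdsWithin] with s hs hsE
    simp only [slope, vsub_eq_sub, smul_eq_mul, abs_mul]
    rw [hE s hsE.1, hE t ht, hs]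
  -- Differentiability of `w` alone suffices, since `deriv` is 0 where `g` has no derivative.
  · rw [deriv_zero_of_not_differentiableAt hg, abs_zero]
    exact abs_nonneg _

/-! ### Locality of the horizontal derivatives -/

namespace CarnotGroup

variable {N : ℕ} (G : CarnotGroup N)

open Filter Topology in
/-- Locality of the horizontal derivatives: where `w = f ∘ u` with `f` a local isometry in the
weak sense `hf`, the derivative of `w` dominates that of `u`. -/
theorem ae_abs_horizontalDeriv_le (μ : Measure (Fin N → ℝ)) [μ.IsAddHaarMeasure]
    {Ω : Set (Fin N → ℝ)} (hΩ : IsOpen Ω) {q : ℝ} {u w : (Fin N → ℝ) → ℝ}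
    (hu : G.MemSobolev μ Ω q u) (hw : G.MemSobolev μ Ω q w) {f : ℝ → ℝ}
    (hf : ∀ s₀, ∀ᶠ s in 𝓝 s₀, |f s - f s₀| = |s - s₀|) {E : Set (Fin N → ℝ)} (hEΩ : E ⊆ Ω)
    (hEm : NullMeasurableSet E μ) (hE : ∀ x ∈ E, w x = f (u x)) (j : G.HorizontalIndex) :
    ∀ᵐ x ∂μ, x ∈ E → |G.horizontalDeriv μ Ω u j x| ≤ |G.horizontalDeriv μ Ω w j x| := by
  have hum := (hu.2.2 j).aestronglyMeasurable.aemeasurable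
  have hwm := (hw.2.2 j).aestronglyMeasurable.aemeasurable
  have hur := hu.2.1.2 j
  have hwr := hw.2.1.2 j
  have hud : G.horizontalDeriv μ Ω u j = fun x => deriv (fun t => hur.choose (G.line j x t)) 0 := by
    ext x; exact dif_pos hur
  have hwd : G.horizontalDeriv μ Ω w j = fun x => deriv (fun t => hwr.choose (G.line j x t)) 0 := by
    ext x; exact dif_pos hwr
  obtain ⟨hueq, huac⟩ := hur.choose_spec
  obtain ⟨hweq, hwac⟩ := hwr.choose_spec
  set v := hur.choose
  set z := hwr.choose
  have hDm : NullMeasurableSet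
      ({x | |G.horizontalDeriv μ Ω w j x| < |G.horizontalDeriv μ Ω u j x|} ∩ E) μ := by
    rw [← nullMeasurableSet_restrict hEm]
    exact nullMeasurableSet_lt (hwm.mono_measure (Measure.restrict_mono_set μ hEΩ)).abs
      (hum.mono_measure (Measure.restrict_mono_set μ hEΩ)).abs
  have hshift : ∀ (g : (Fin N → ℝ) → ℝ) (x : Fin N → ℝ) (t : ℝ),
      deriv (fun s => g (G.line j (G.line j x t) s)) 0 = deriv (fun s => g (G.line j x s)) t := by
    intro g x t
    simp only [G.line_line]
    simpa using deriv_comp_const_add (fun s => g (G.line j x s)) t 0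
  have hT : ∀ᵐ x ∂μ, x ∈ Ω → v x = u x ∧ z x = w x := by
    filter_upwards [(ae_restrict_iff' hΩ.measurableSet).1 hueq,
      (ae_restrict_iff' hΩ.measurableSet).1 hweq] with x h1 h2 hx using ⟨h1 hx, h2 hx⟩
  have hnull := G.ae_of_ae_ae_line μ j hDm ?_
  · filter_upwards [measure_eq_zero_iff_ae_notMem.1 hnull] with x hx hxE
    by_contra hlt
    exact hx ⟨not_le.1 hlt, hxE⟩
  filter_upwards [G.ae_ae_line μ j hT, G.ae_of_ae_hyperplaneMeasure μ j hwac] with x hx hac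
  -- Absolute continuity is known for the parametrization starting on the hyperplane; shifting time
  -- by x_j transfers it to the one starting at x.
  have hdiff : ∀ᵐ t : ℝ, G.line j x t ∈ Ω → DifferentiableAt ℝ (fun s => z (G.line j x s)) t := by
    set c := x j.1
    have h1 := ae_differentiableAt_of_absolutelyContinuousOnInterval
      (hΩ.preimage (G.continuous_line j (G.line j x (-c)))) hac
    have h2 := (quasiMeasurePreserving_add_right (volume : Measure ℝ) c).ae h1
    filter_upwards [h2] with t ht htΩ
    have e : ∀ s, G.line j (G.line j x (-c)) (s + c) = G.line j x s := fun s => by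
      rw [G.line_line]; congr 1; ring
    have h3 := ht (by rw [Set.mem_preimage, e]; exact htΩ)
    have h4 := h3.comp t ((differentiableAt_id (𝕜 := ℝ)).add_const c)
    refine h4.congr_of_eventuallyEq (Eventually.of_forall fun s => ?_)
    simp [e]
  filter_upwards [hx, hdiff, ae_mem_imp_neBot_nhdsWithin_diff_singleton
    {t | G.line j x t ∈ E ∧ v (G.line j x t) = u (G.line j x t) ∧
      z (G.line j x t) = w (G.line j x t)}] with t ht htd hne hmem
  obtain ⟨hlt, htE⟩ := hmem
  have hmem : G.line j x t ∈ E ∧ v (G.line j x t) = u (G.line j x t) ∧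
      z (G.line j x t) = w (G.line j x t) := ⟨htE, ht (hEΩ htE)⟩
  rw [Set.mem_ofPred_eq] at hlt
  refine absurd hlt (not_lt.2 ?_)
  simp only [hud, hwd, hshift]
  refine abs_deriv_le_of_eventually_abs_sub_eq hf ?_ hmem (hne hmem) (htd (hEΩ htE))
  rintro s ⟨hs, h1, h2⟩
  rw [h1, h2, hE _ hs]

end CarnotGroup

/-! ### The sawtooth function -/

/-- The distance of `s` to the nearest integer. -/
noncomputable def distRound (s : ℝ) : ℝ := |s - round s|

theorem distRound_sub_le (a b : ℝ) : distRound a - distRound b ≤ |a - b| := by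
  unfold distRound
  have h := round_le a (round b)
  have := abs_sub_le a b (round b)
  linarith

theorem distRound_eq (s : ℝ) (k : ℤ) (h : |s - k| ≤ 1 / 2) : distRound s = |s - k| := by
  unfold distRound
  refine le_antisymm (round_le s k) ?_
  by_cases hk : round s = k
  · rw [hk]
  · have h1 : (1 : ℝ) ≤ |(k : ℝ) - round s| := by
      have : 1 ≤ |k - round s| := Int.one_le_abs (sub_ne_zero.2 (Ne.symm hk))
      exact_mod_cast this
    have h2 := abs_sub_le (k : ℝ) s (round s)
    rw [abs_sub_comm (k : ℝ) s] at h2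
    linarith

open Filter Topology in
-- The slopes on the two sides of a corner are ±1, so equality in absolute value survives there.
-- Hence no values of u need to be excluded. The cases separate integers and half-integers from the
-- points between.
theorem eventually_abs_distRound_sub (s₀ : ℝ) :
    ∀ᶠ s in 𝓝 s₀, |distRound s - distRound s₀| = |s - s₀| := by
  have h0 := abs_sub_round s₀
  set k := round s₀ with hk
  have hs0 := distRound_eq s₀ k h0
  rcases abs_le.1 h0 with ⟨ha, hb⟩
  rcases lt_trichotomy s₀ k with hlt | heq | hgt
  · rcases ha.lt_or_eq with hlt' | heq'
    · filter_upwards [Ioo_mem_nhds (a := (k : ℝ) - 1 / 2) (b := k) (by linarith) hlt] with s hs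
      rw [hs0, distRound_eq s k (abs_le.2 ⟨by linarith [hs.1], by linarith [hs.2]⟩),
        abs_of_neg (by linarith : s₀ - k < 0), abs_of_neg (by linarith [hs.2] : s - k < 0),
        abs_sub_comm s]
      congr 1; ring
    · filter_upwards [Ioo_mem_nhds (a := s₀ - 1 / 2) (b := s₀ + 1 / 2) (by linarith)
        (by linarith)] with s hs
      rw [hs0, abs_of_neg (by linarith : s₀ - k < 0)]
      rcases le_total s s₀ with h | h
      · rw [distRound_eq s (k - 1) (by push_cast; exact abs_le.2 ⟨by linarith [hs.1], by linarith⟩)]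
        push_cast
        rw [abs_of_nonneg (by linarith [hs.1] : 0 ≤ s - (k - 1))]
        congr 1; linarith
      · rw [distRound_eq s k (abs_le.2 ⟨by linarith, by linarith [hs.2]⟩),
          abs_of_nonpos (by linarith [hs.2] : s - k ≤ 0), abs_sub_comm s]
        congr 1; ring
  · filter_upwards [Ioo_mem_nhds (a := s₀ - 1 / 2) (b := s₀ + 1 / 2) (by linarith)
        (by linarith)] with s hs
    rw [hs0, distRound_eq s k (abs_le.2 ⟨by linarith [hs.1], by linarith [hs.2]⟩), ← heq]
    simp
  · rcases hb.lt_or_eq with hlt' | heq'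
    · filter_upwards [Ioo_mem_nhds (a := (k : ℝ)) (b := k + 1 / 2) hgt (by linarith)] with s hs
      rw [hs0, distRound_eq s k (abs_le.2 ⟨by linarith [hs.1], by linarith [hs.2]⟩),
        abs_of_pos (by linarith : 0 < s₀ - k), abs_of_pos (by linarith [hs.1] : 0 < s - k)]
      congr 1; ring
    · filter_upwards [Ioo_mem_nhds (a := s₀ - 1 / 2) (b := s₀ + 1 / 2) (by linarith)
        (by linarith)] with s hs
      rw [hs0, abs_of_pos (by linarith : 0 < s₀ - k)]
      rcases le_total s s₀ with h | h
      · rw [distRound_eq s k (abs_le.2 ⟨by linarith [hs.1], by linarith⟩),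
          abs_of_nonneg (by linarith [hs.1] : 0 ≤ s - k)]
        congr 1; ring
      · rw [distRound_eq s (k + 1) (by push_cast; exact abs_le.2 ⟨by linarith, by linarith [hs.2]⟩)]
        push_cast
        rw [abs_of_nonpos (by linarith [hs.2] : s - (k + 1) ≤ 0), abs_sub_comm s]
        congr 1; linarith

/-- The sawtooth function of slopes `±1` and range `[0, η]`. -/
noncomputable def sawtooth (η s : ℝ) : ℝ := 2 * η * distRound (s / (2 * η))

theorem sawtooth_nonneg {η : ℝ} (hη : 0 < η) (s : ℝ) : 0 ≤ sawtooth η s :=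
  mul_nonneg (by linarith) (abs_nonneg _)

theorem sawtooth_le {η : ℝ} (hη : 0 < η) (s : ℝ) : sawtooth η s ≤ η := by
  have := mul_le_mul_of_nonneg_left (abs_sub_round (s / (2 * η))) (by linarith : 0 ≤ 2 * η)
  unfold sawtooth distRound
  linarith

theorem lipschitzWith_sawtooth {η : ℝ} (hη : 0 < η) : LipschitzWith 1 (sawtooth η) := by
  refine LipschitzWith.of_le_add fun a b => ?_
  have h := mul_le_mul_of_nonneg_left (distRound_sub_le (a / (2 * η)) (b / (2 * η)))
    (by linarith : 0 ≤ 2 * η)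
  rw [← sub_div, abs_div, abs_of_pos (by linarith : 0 < 2 * η), mul_div_cancel₀ _ (by linarith)] at h
  rw [Real.dist_eq]
  unfold sawtooth
  linarith

open Filter Topology in
theorem eventually_abs_sawtooth_sub {η : ℝ} (hη : 0 < η) (s₀ : ℝ) :
    ∀ᶠ s in 𝓝 s₀, |sawtooth η s - sawtooth η s₀| = |s - s₀| := by
  have hc : ContinuousAt (fun s : ℝ => s / (2 * η)) s₀ := by fun_prop
  filter_upwards [hc.tendsto.eventually (eventually_abs_distRound_sub (s₀ / (2 * η)))] with s hs
  unfold sawtooth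
  rw [← mul_sub, abs_mul, hs, ← sub_div, abs_div, abs_of_pos (by linarith : 0 < 2 * η),
    mul_div_cancel₀ _ (by linarith)]

/-! ### The cutoff and the exhaustion of V -/

theorem setDist_tsupport_compl_pos {Y : Type*} [MetricSpace Y] {V : Set Y} {u : Y → ℝ} {ε : ℝ}
    (hε : 0 < ε) (hu : ∀ y, u y ≠ 0 → ε ≤ Metric.infDist y Vᶜ) :
    0 < setDist (tsupport u) Vᶜ := by
  have hsub : tsupport u ⊆ {y | ε ≤ Metric.infDist y Vᶜ} :=
    closure_minimal (fun y hy => hu y hy)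
      (isClosed_le continuous_const (Metric.continuous_infDist_pt _))
  refine lt_of_lt_of_le (ENNReal.ofReal_pos.2 hε) ?_
  refine le_iInf₂ fun x hx => le_iInf₂ fun y hy => ?_
  rw [edist_dist]
  exact ENNReal.ofReal_le_ofReal ((hsub hx).trans (Metric.infDist_le_dist_of_mem hy))

theorem CarnotGroup.enorm_horizontalGradient_le {N : ℕ} (G : CarnotGroup N)
    (μ : Measure (Fin N → ℝ)) (Ω : Set (Fin N → ℝ)) {u w : (Fin N → ℝ) → ℝ} {x : Fin N → ℝ}
    (h : ∀ j, |G.horizontalDeriv μ Ω u j x| ≤ |G.horizontalDeriv μ Ω w j x|) :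
    ‖G.horizontalGradient μ Ω u x‖ₑ ≤ ‖G.horizontalGradient μ Ω w x‖ₑ := by
  rw [← ofReal_norm, ← ofReal_norm]
  refine ENNReal.ofReal_le_ofReal ?_
  rw [EuclideanSpace.norm_eq, EuclideanSpace.norm_eq]
  refine Real.sqrt_le_sqrt (Finset.sum_le_sum fun j _ => ?_)
  exact pow_le_pow_left₀ (norm_nonneg _) (h j) 2

/-- A `1`-Lipschitz function supported at distance at least `ε` from `Vᶜ` which is a sawtooth
function of `u` at distance more than `2ε` from `Vᶜ`. -/
noncomputable def sawtoothCutoff {Y : Type*} [MetricSpace Y] (V : Set Y) (ε : ℝ) (u : Y → ℝ) (y : Y) : ℝ :=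
  min (sawtooth ε (u y)) (max (Metric.infDist y Vᶜ - ε) 0)

theorem lipschitzWith_infDist_sub_max {Y : Type*} [MetricSpace Y] (V : Set Y) (ε : ℝ) :
    LipschitzWith 1 fun y => max (Metric.infDist y Vᶜ - ε) 0 :=
  LipschitzWith.max_const (LipschitzWith.of_le_add fun x y => by
    have := Metric.infDist_le_infDist_add_dist (s := Vᶜ) (x := x) (y := y)
    linarith) 0

theorem lipschitzWith_sawtoothCutoff {Y : Type*} [MetricSpace Y] (V : Set Y) {ε : ℝ} (hε : 0 < ε)
    {u : Y → ℝ} (hu : LipschitzWith 1 u) : LipschitzWith 1 (sawtoothCutoff V ε u) := by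
  have := ((lipschitzWith_sawtooth hε).comp hu).min (lipschitzWith_infDist_sub_max V ε)
  rw [mul_one, max_self] at this
  exact this

/-- Removal of the support condition: a bound for the `q`-energy over `φ⁻¹(V)` of `u ∘ φ` for all
`1`-Lipschitz `u` supported at a positive distance from the complement of `V` carries over, with
the same constant, to all `1`-Lipschitz `u` such that `u ∘ φ` is in `L^1_q(Ω)`. -/
theorem lemma4p3 {N : ℕ} (G : CarnotGroup N)
    (μ : Measure (Fin N → ℝ)) [μ.IsAddHaarMeasure]
    (Ω : Set (Fin N → ℝ)) (hΩ_open : IsOpen Ω) (hΩ_conn : IsConnected Ω)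
    {Y : Type*} [MetricSpace Y] (φ : (Fin N → ℝ) → Y)
    (V : Set Y) (hV : IsOpen V) (A : ℝ) (hA : 0 ≤ A) (q : ℝ) (hq : 1 ≤ q)
    (h : ∀ u : Y → ℝ, LipschitzWith 1 u → 0 < setDist (tsupport u) Vᶜ →
      G.MemSobolev μ Ω q (u ∘ φ) ∧
      ∫⁻ x in Ω ∩ φ ⁻¹' V, ‖G.horizontalGradient μ Ω (u ∘ φ) x‖ₑ ^ q ∂μ ≤ ENNReal.ofReal A) :
    ∀ u : Y → ℝ, LipschitzWith 1 u → G.MemSobolev μ Ω q (u ∘ φ) →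
      ∫⁻ x in Ω ∩ φ ⁻¹' V, ‖G.horizontalGradient μ Ω (u ∘ φ) x‖ₑ ^ q ∂μ ≤ ENNReal.ofReal A := by
  intro u hu hmem
  rcases Set.eq_empty_or_nonempty Vᶜ with hVc | hVc
  -- If V = Y the support condition is void. The case is separate because `Metric.infDist` to the
  -- empty set is 0.
  · refine (h u hu ?_).2
    simp [setDist, hVc]
  set δ : Y → ℝ := fun y => Metric.infDist y Vᶜ with hδ
  set ε : ℕ → ℝ := fun n => 1 / ((n : ℝ) + 1) with hε
  have hεpos : ∀ n, 0 < ε n := fun n => Nat.one_div_pos_of_nat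
  set E : ℕ → Set (Fin N → ℝ) := fun n => Ω ∩ φ ⁻¹' {y | 2 * ε n < δ y} with hE
  have hunion : Ω ∩ φ ⁻¹' V = ⋃ n, E n := by
    rw [hE, ← Set.inter_iUnion, ← Set.preimage_iUnion]
    congr 2
    ext y
    simp only [Set.mem_iUnion, Set.mem_ofPred_eq]
    constructor
    · intro hy
      have hpos : 0 < δ y := (hV.isClosed_compl.notMem_iff_infDist_pos hVc).1 (fun hn => hn hy)
      obtain ⟨n, hn⟩ := exists_nat_one_div_lt (half_pos hpos)
      exact ⟨n, by simp only [hε]; linarith⟩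
    · rintro ⟨n, hn⟩
      by_contra hy
      have : δ y = 0 := Metric.infDist_zero_of_mem hy
      linarith [hεpos n]
  have hmono : Monotone E := fun m n hmn x hx =>
    ⟨hx.1, lt_of_le_of_lt (show 2 * ε n ≤ 2 * ε m from
      mul_le_mul_of_nonneg_left (Nat.one_div_le_one_div hmn) zero_le_two) hx.2⟩
  rw [hunion, setLIntegral_iUnion_of_directed _ hmono.directed_le]
  refine iSup_le fun n => ?_
  -- Nothing is assumed about φ, so measurability of E_n is extracted from the hypothesis, applied
  -- to the truncated distance function.
  have hcut := h (fun y => max (δ y - ε n) 0) (lipschitzWith_infDist_sub_max V (ε n))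
    (setDist_tsupport_compl_pos (hεpos n) fun y hy => by
      by_contra hlt
      exact hy (max_eq_right (by linarith)))
  have hEm : NullMeasurableSet (E n) μ := by
    have hset : E n = {x | ε n < ((fun y => max (δ y - ε n) 0) ∘ φ) x} ∩ Ω := by
      ext x
      have := hεpos n
      simp only [hE, Set.mem_inter_iff, Set.mem_preimage, Set.mem_ofPred_eq, Function.comp,
        lt_max_iff]
      constructor
      · rintro ⟨h1, h2⟩; exact ⟨Or.inl (by linarith), h1⟩
      · rintro ⟨h1 | h1, h2⟩
        · exact ⟨h2, by linarith⟩
        · linarith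
    rw [hset, ← nullMeasurableSet_restrict hΩ_open.measurableSet.nullMeasurableSet]
    exact nullMeasurableSet_lt aemeasurable_const hcut.1.2.1.1
  obtain ⟨hwmem, hwint⟩ := h _ (lipschitzWith_sawtoothCutoff V (hεpos n) hu)
    (setDist_tsupport_compl_pos (hεpos n) fun y hy => by
      by_contra hlt
      refine hy ?_
      rw [sawtoothCutoff, max_eq_right (by linarith)]
      exact min_eq_right (sawtooth_nonneg (hεpos n) _))
  -- The factor 2 in E_n enters here: the sawtooth is at most ε, and δ - ε > ε on E_n, so the
  -- minimum is the sawtooth.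
  have hloc : ∀ x ∈ E n, (sawtoothCutoff V (ε n) u ∘ φ) x = sawtooth (ε n) ((u ∘ φ) x) :=
    fun x hx => min_eq_left ((sawtooth_le (hεpos n) _).trans (le_max_of_le_left (by
      have : 2 * ε n < δ (φ x) := hx.2
      simp only [hδ] at this
      linarith)))
  have hae : ∀ᵐ x ∂μ, x ∈ E n → ∀ j, |G.horizontalDeriv μ Ω (u ∘ φ) j x| ≤
      |G.horizontalDeriv μ Ω (sawtoothCutoff V (ε n) u ∘ φ) j x| := by
    have := ae_all_iff.2 fun j => G.ae_abs_horizontalDeriv_le μ hΩ_open hmem hwmem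
      (eventually_abs_sawtooth_sub (hεpos n)) Set.inter_subset_left hEm hloc j
    filter_upwards [this] with x hx hxE j using hx j hxE
  calc ∫⁻ x in E n, ‖G.horizontalGradient μ Ω (u ∘ φ) x‖ₑ ^ q ∂μ
      ≤ ∫⁻ x in E n, ‖G.horizontalGradient μ Ω (sawtoothCutoff V (ε n) u ∘ φ) x‖ₑ ^ q ∂μ :=
        lintegral_mono_ae ((ae_restrict_iff'₀ hEm).2 (hae.mono fun x hx hxE =>
          ENNReal.rpow_le_rpow (G.enorm_horizontalGradient_le μ Ω (hx hxE)) (by linarith)))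
    _ ≤ ∫⁻ x in Ω ∩ φ ⁻¹' V,
          ‖G.horizontalGradient μ Ω (sawtoothCutoff V (ε n) u ∘ φ) x‖ₑ ^ q ∂μ :=
        lintegral_mono_set (hunion ▸ Set.subset_iUnion E n)
    _ ≤ ENNReal.ofReal A := hwint
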